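/- Let $k$ and $l$ be positive integers with $l<k$ and $\gcd(l,k)=1$, let $\mathrm{GF}(2^k)$ be the field with $2^k$ elements, and let $\mathrm{Tr}_k(x)=\sum_{i=0}^{k-1}x^{2^i}$ be the absolute trace on it. Let $l'\in\{1,\dots,k-1\}$ be the inverse of $l$ modulo $k$. Define polynomials over $\mathrm{GF}(2^k)$ as follows. \[A_1(x)=x,\quad A_2(x)=x^{2^l+1},\quad A_{i+2}(x)=x^{2^{(i+1)l}}A_{i+1}(x)+x^{2^{(i+1)l}-2^{il}}A_i(x)\quad(i\ge 1),\] \[B_1(x)=0,\quad B_2(x)=x^{2^l-1},\quad B_{i+2}(x)=x^{2^{(i+1)l}}B_{i+1}(x)+x^{2^{(i+1)l}-2^{il}}B_i(x)\quad(i\ge 1),\] \[R(x)=\sum_{i=1}^{l'}A_i(x)+B_{l'}(x),\] \[C_1(x)=C_2(x)=1,\quad C_{i+2}(x)=C_{i+1}(x)+x^{2^{il}}C_i(x)\quad(i\ge 1),\] \[Z_1(x)=1,\quad Z_n(x)=C_{n+1}(x)+x\,C_{n-1}(x)^{2^l}\quad(n>1).\] Then for every nonzero $a\in\mathrm{GF}(2^k)$,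 \[\mathrm{Tr}_k\bigl(R(a^{-1})+1\bigr)=1\quad\text{if and only if}\quad Z_k(a)=0\ \text{ and }\ C_k(a)\neq 0.\] -/

import Mathlib

open Polynomial

namespace DobbertinTrace

/-- The inverse `l' = l⁻¹ (mod k)`, as an integer in `{0, …, k - 1}`
(meaningful when `gcd(l, k) = 1`). -/
def invMod (l k : ℕ) : ℕ := ((l : ZMod k)⁻¹).val

/-- `invMod l k` is the representative in `{1, …, k - 1}` of the inverse of `l` modulo `k`. -/
theorem invMod_spec {l k : ℕ} (hk : 1 < k) (h : Nat.Coprime l k) :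
    0 < invMod l k ∧ invMod l k < k ∧ l * invMod l k ≡ 1 [MOD k] := by
  have : NeZero k := ⟨by omega⟩
  have h1 : l * invMod l k ≡ 1 [MOD k] := by
    rw [← ZMod.natCast_eq_natCast_iff]
    push_cast
    rw [invMod, ZMod.natCast_zmod_val]
    exact ZMod.coe_mul_inv_eq_one l h
  refine ⟨?_, ZMod.val_lt _, h1⟩
  rcases Nat.eq_zero_or_pos (invMod l k) with h0 | h0
  · rw [h0, mul_zero] at h1
    have := Nat.ModEq.eq_of_lt_of_lt h1 (by omega) hk
    omega
  · exact h0

/-- The absolute trace `Tr_k(x) = ∑_{i=0}^{k-1} x^(2^i)` on a field with `2^k` elements. -/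
def tr {F : Type*} [Field F] (k : ℕ) (x : F) : F := ∑ i ∈ Finset.range k, x ^ 2 ^ i

section

variable (F : Type*) [Field F]

/-- The polynomials `A_i`: `A_1 = x`, `A_2 = x^(2^l+1)`,
`A_{i+2} = x^(2^((i+1)l)) A_{i+1} + x^(2^((i+1)l) - 2^(il)) A_i` for `i ≥ 1`.
The index `0` is not used. -/
noncomputable def polyA (l : ℕ) : ℕ → F[X]
  | 0 => 0
  | 1 => X
  | 2 => X ^ (2 ^ l + 1)
  | i + 3 => X ^ 2 ^ ((i + 2) * l) * polyA l (i + 2)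
      + X ^ (2 ^ ((i + 2) * l) - 2 ^ ((i + 1) * l)) * polyA l (i + 1)

/-- The polynomials `B_i`: `B_1 = 0`, `B_2 = x^(2^l-1)`,
`B_{i+2} = x^(2^((i+1)l)) B_{i+1} + x^(2^((i+1)l) - 2^(il)) B_i` for `i ≥ 1`.
The index `0` is not used. -/
noncomputable def polyB (l : ℕ) : ℕ → F[X]
  | 0 => 0
  | 1 => 0
  | 2 => X ^ (2 ^ l - 1)
  | i + 3 => X ^ 2 ^ ((i + 2) * l) * polyB l (i + 2)
      + X ^ (2 ^ ((i + 2) * l) - 2 ^ ((i + 1) * l)) * polyB l (i + 1)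

/-- The Dobbertin polynomial `R = ∑_{i=1}^{l'} A_i + B_{l'}`, where `l' = l⁻¹ (mod k)`. -/
noncomputable def polyR (k l : ℕ) : F[X] :=
  (∑ i ∈ Finset.Icc 1 (invMod l k), polyA F l i) + polyB F l (invMod l k)

/-- The polynomials `C_i`: `C_1 = C_2 = 1`, `C_{i+2} = C_{i+1} + x^(2^(il)) C_i` for `i ≥ 1`.
The index `0` is not used. -/
noncomputable def polyC (l : ℕ) : ℕ → F[X]
  | 0 => 0
  | 1 => 1
  | 2 => 1
  | i + 3 => polyC l (i + 2) + X ^ 2 ^ ((i + 1) * l) * polyC l (i + 1)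

/-- The polynomials `Z_n`: `Z_1 = 1`, `Z_n = C_{n+1} + x C_{n-1}^(2^l)` for `n > 1`.
The index `0` is not used. -/
noncomputable def polyZ (l : ℕ) : ℕ → F[X]
  | 0 => 0
  | 1 => 1
  | n + 2 => polyC F l (n + 3) + X * polyC F l (n + 1) ^ 2 ^ l

end

end DobbertinTrace

/-! Write `σ(x) = x^(2^l)` and `L(x) = σ(a)σ²(x) + σ(x) + ax`. The value `v = R(a⁻¹)` satisfies
`L(v) = 1` (`linPoly_eval_polyR`). The symmetric form `B(x,y) = Tr(L(x)σ(y))` has radical `ker L`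
and `B(x,x) = Tr(x) = B(v,x)`, so `v` is characteristic and `Tr(v) = B(v,v)` is the parity of the
rank, `k + dim ker L` (`trace_of_linPoly_eq_one`). As `Tr(1) = k`, the left side says that `dim ker
L` is odd.

If `w ≠ 0` lies in `ker L`, a Wronskian argument shows that the dimension is odd exactly when `t =
Tr((a w σ(w))⁻¹)` is nonzero (`finrank_ker_linPoly`), while `C_k(a)² = w² t` and `Z_k(a) = 0`
(`seqC_of_kernel`). Conversely, if `Z_k(a) = 0` and `C_k(a) ≠ 0`, then `C_k(a)` is such a `w`
(`seqC_mem_kernel`). -/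

namespace DobbertinTrace

/-! ### Symmetric bilinear forms over `𝔽₂` and characteristic vectors. -/

section SymmetricForm

variable {V : Type*} [AddCommGroup V] [Module (ZMod 2) V] [FiniteDimensional (ZMod 2) V]

theorem zmod_two_eq_one {c : ZMod 2} (h : c ≠ 0) : c = 1 := by
  revert c; decide

/-- A linear functional that does not vanish on `W` cuts out a hyperplane of `W`. -/
theorem finrank_inf_ker_add_one {W : Submodule (ZMod 2) V} (f : V →ₗ[ZMod 2] ZMod 2) {x : V}
    (hx : x ∈ W) (hfx : f x ≠ 0) :
    Module.finrank (ZMod 2) (W ⊓ LinearMap.ker f : Submodule (ZMod 2) V) + 1 =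
      Module.finrank (ZMod 2) W := by
  have hne : f.domRestrict W ≠ 0 := fun h => hfx (by
    simpa using LinearMap.congr_fun h ⟨x, hx⟩)
  rw [← Module.Dual.finrank_ker_add_one_of_ne_zero hne]
  congr 1
  have : W ⊓ LinearMap.ker f = (LinearMap.ker (f.domRestrict W)).map W.subtype := by
    ext y
    simp [and_comm]
  rw [this]
  exact Submodule.finrank_map_subtype_eq W _

/-- If `v` is a characteristic vector of a symmetric bilinear form over `𝔽₂` restricted to `W`, then
`B v v` is the parity of the rank of the form on `W`. -/
theorem apply_self_eq_finrank_add_finrank_radical (B : V →ₗ[ZMod 2] V →ₗ[ZMod 2] ZMod 2)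
    (hB : ∀ x y, B x y = B y x) (W R : Submodule (ZMod 2) V)
    (hR : ∀ x, x ∈ R ↔ x ∈ W ∧ ∀ y ∈ W, B y x = 0) (v : V) (hv : v ∈ W)
    (hchar : ∀ x ∈ W, B x x = B v x) :
    B v v = Module.finrank (ZMod 2) W + Module.finrank (ZMod 2) R := by
  induction hn : Module.finrank (ZMod 2) W using Nat.strong_induction_on
    generalizing W R v with | _ n ih
  by_cases h1 : ∃ x ∈ W, B x x ≠ 0
  · obtain ⟨x, hx, hxx⟩ := h1
    have hxx1 := zmod_two_eq_one hxx
    have hd := finrank_inf_ker_add_one (B x) hx hxx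
    have hxv : B x v = 1 := by rw [hB, ← hchar x hx, hxx1]
    -- Split off the anisotropic line of `x`: the radical is unchanged, and `v + x` is
    -- characteristic on the orthogonal complement.
    have key := ih _ (by omega) (W ⊓ LinearMap.ker (B x)) R (fun y => by
      rw [hR]
      constructor
      · rintro ⟨hy, h⟩
        exact ⟨⟨hy, h x hx⟩, fun z hz => h z hz.1⟩
      · rintro ⟨⟨hy, hxy⟩, h⟩
        refine ⟨hy, fun z hz => ?_⟩
        have := h (z + B x z • x) ⟨add_mem hz (W.smul_mem _ hx), by
          simp [hxx1, CharTwo.add_self_eq_zero]⟩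
        simpa [LinearMap.mem_ker.1 hxy] using this) (v + x)
      ⟨add_mem hv hx, by simp [hxx1, hxv, CharTwo.add_self_eq_zero]⟩
      (fun y hy => by simp [LinearMap.mem_ker.1 hy.2, hchar y hy.1]) rfl
    rw [← hn, ← hd]
    have h3 : B (v + x) (v + x) = B v v + 1 := by
      simp only [map_add, LinearMap.add_apply, hB v x, hxv, hxx1]
      linear_combination CharTwo.add_self_eq_zero (1 : ZMod 2)
    rw [h3] at key
    push_cast
    linear_combination key - CharTwo.add_self_eq_zero (1 : ZMod 2)
  · push Not at h1
    by_cases h2 : ∃ x ∈ W, ∃ z ∈ W, B x z ≠ 0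
    · obtain ⟨x, hx, z, hz, hxz⟩ := h2
      have hxz1 := zmod_two_eq_one hxz
      have hd := finrank_inf_ker_add_one (B x) hz hxz
      -- The form is now alternating. Passing to `W'` loses one dimension but puts `x` into the
      -- radical, so the sum of the two dimensions is preserved.
      set W' := W ⊓ LinearMap.ker (B x) with hW'
      let R' : Submodule (ZMod 2) V := W' ⊓ ⨅ y : W', LinearMap.ker (B y)
      have hR' : ∀ y, y ∈ R' ↔ y ∈ W' ∧ ∀ u ∈ W', B u y = 0 := fun y => by
        simp [R', Submodule.mem_iInf]
      have hRR : R = R' ⊓ LinearMap.ker (B z) := by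
        ext y
        rw [hR, Submodule.mem_inf, hR', LinearMap.mem_ker]
        constructor
        · rintro ⟨hy, h⟩
          exact ⟨⟨⟨hy, h x hx⟩, fun u hu => h u hu.1⟩, h z hz⟩
        · rintro ⟨⟨hy, h⟩, hzy⟩
          refine ⟨hy.1, fun u hu => ?_⟩
          have := h (u + B x u • z) ⟨add_mem hu (W.smul_mem _ hz), by
            simp [hxz1, CharTwo.add_self_eq_zero]⟩
          simpa [hzy] using this
      have hxR' : x ∈ R' := (hR' x).2 ⟨⟨hx, h1 x hx⟩, fun u hu => by
        rw [hB]; exact hu.2⟩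
      have hd' := finrank_inf_ker_add_one (B z) hxR' (by rwa [hB])
      rw [← hRR] at hd'
      have key := ih _ (by omega) W' R' hR' v
        ⟨hv, LinearMap.mem_ker.2 (by rw [hB, ← hchar x hx, h1 x hx])⟩
        (fun y hy => hchar y hy.1) rfl
      rw [key, ← hn, ← hd, ← hd']
      push_cast
      ring
    · push Not at h2
      have : R = W := by
        ext y
        rw [hR]
        exact ⟨fun h => h.1, fun h => ⟨h, fun u hu => h2 u hu y h⟩⟩
      rw [this, h1 v hv, hn, CharTwo.add_self_eq_zero]

end SymmetricForm

/-! ### The sequence `A` and the equation `L(x) = 1`. -/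

section Recursions

variable {F : Type*} [Field F] (σ : F →+* F)

/-- The field algebra of `seqA_solution`: the digit counts applications of `σ`; `a`, `b`, `c` stand
for `A m`, `A (m + 1)`, `A (m + 2)`, `d` for `s 0`, and `T` for the sum of `A 1, …, A m`. -/
theorem solution_aux [CharP F 2] {d d1 d2 T T1 T2 a1 a2 a3 b0 b1 b2 c0 c1 : F} (h0 : d ≠ 0) (h1 : d1 ≠ 0)
    (hsum : T + b0 + c0 - d = d * (T1 + b1) + d / d1 * T2)
    (hP : c0 = d * b1 + d / d1 * a2) (hP' : c1 = d1 * b2 + d1 / d2 * a3)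
    (hQ : c1 = d1 ^ 2 * b1 + d1 ^ 2 / d ^ 2 * a1) :
    T2 + b2 + a3 / d2 = d1 * (T1 + b1 + a2 / d1 + (T + b0 + a1 / d) / d + 1) := by
  have hT : T2 = d1 / d * (T + b0 + c0 - d) - d1 * (T1 + b1) := by
    rw [hsum]; field_simp; ring
  have hb : b2 + a3 / d2 = d1 * b1 + d1 / d ^ 2 * a1 := by
    have : d1 * (b2 + a3 / d2) = d1 * (d1 * b1 + d1 / d ^ 2 * a1) := by
      linear_combination hQ - hP'
    exact mul_left_cancel₀ h1 this
  rw [add_assoc, hb, hT, hP]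
  have two : (2 : F) = 0 := CharTwo.two_eq_zero
  field_simp
  linear_combination (-d1 * d ^ 2 * (1 + T1) ) * two

section SequenceA

variable {s A : ℕ → F} (hs : ∀ i, σ (s i) = s (i + 1)) (hs0 : ∀ i, s i ≠ 0)
  (hA0 : A 0 = 0) (hA1 : A 1 = s 0)
  (hA : ∀ i, A (i + 2) = s (i + 1) * A (i + 1) + s (i + 1) / s i * A i)

include hs hs0 hA0 hA1 hA

/-- The recursion for `A` expanded at the other end. -/
theorem seqA_left_rec (i : ℕ) :
    A (i + 2) = s 0 * σ (A (i + 1)) + s 0 / s 1 * σ (σ (A i)) := by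
  induction i using Nat.twoStepInduction with
  | zero => simp [hA, hA0, hA1, hs, mul_comm]
  | one =>
    have := hs0 1
    have := hs0 0
    simp only [hA, hA0, hA1, hs, map_add, map_mul, map_div₀, map_zero]
    field_simp
    ring
  | more i h1 h2 =>
    have e : σ (σ (A (i + 2))) = s (i + 3) * σ (σ (A (i + 1)))
        + s (i + 3) / s (i + 2) * σ (σ (A i)) := by
      rw [hA i]; simp [hs]
    have e' : σ (A (i + 3)) = s (i + 3) * σ (A (i + 2)) + s (i + 3) / s (i + 2) * σ (A (i + 1)) := by
      rw [hA (i + 1)]; simp [hs]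
    linear_combination hA (i + 2) + s (i + 3) * h2 + s (i + 3) / s (i + 2) * h1 - s 0 * e'
      - s 0 / s 1 * e

theorem sum_seqA (m : ℕ) :
    ∑ i ∈ Finset.range (m + 1), A (i + 1) + A (m + 2) - s 0 =
      s 0 * σ (∑ i ∈ Finset.range (m + 1), A (i + 1)) +
        s 0 / s 1 * σ (σ (∑ i ∈ Finset.range m, A (i + 1))) := by
  rw [← Finset.sum_range_succ (fun i => A (i + 1)), Finset.sum_range_succ', zero_add, hA1]
  simp only [map_sum, Finset.mul_sum, seqA_left_rec σ hs hs0 hA0 hA1 hA,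
    Finset.sum_add_distrib]
  rw [Finset.sum_range_succ' (fun i => s 0 / s 1 * σ (σ (A i)))]
  simp [hA0]

/-- `∑ A_i + σ(A_m)/s_0` solves the inhomogeneous linear equation, provided that `σ^(m+1)` squares
`s_0`. -/
theorem seqA_solution [CharP F 2] (m : ℕ) (hm : s (m + 1) = s 0 ^ 2) (x : F)
    (hx : x = ∑ i ∈ Finset.range (m + 1), A (i + 1) + σ (A m) / s 0) :
    σ (σ x) = s 1 * (σ x + x / s 0 + 1) := by
  have hsum := sum_seqA σ hs hs0 hA0 hA1 hA m
  have hP := seqA_left_rec σ hs hs0 hA0 hA1 hA m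
  have h0 := hs0 0
  have h1 := hs0 1
  have hm' : s (m + 2) = s 1 ^ 2 := by
    rw [← hs (m + 1), hm, map_pow, hs]
  have hP' : σ (A (m + 2)) = s 1 * σ (σ (A (m + 1))) + s 1 / s 2 * σ (σ (σ (A m))) := by
    rw [hP]; simp [hs]
  -- The recursion at the right end, with the squaring hypothesis inserted; comparison with `hP'`
  -- closes the system.
  have hQ : σ (A (m + 2)) = s 1 ^ 2 * σ (A (m + 1)) + s 1 ^ 2 / s 0 ^ 2 * σ (A m) := by
    rw [hA, map_add, map_mul, map_mul, map_div₀, hs, hs, hm', hm]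
  rw [Finset.sum_range_succ] at hsum hx
  simp only [map_add] at hsum
  have hx1 : σ x = σ (∑ i ∈ Finset.range m, A (i + 1)) + σ (A (m + 1)) + σ (σ (A m)) / s 1 := by
    rw [hx]; simp [hs]
  have hx2 : σ (σ x) = σ (σ (∑ i ∈ Finset.range m, A (i + 1))) + σ (σ (A (m + 1)))
      + σ (σ (σ (A m))) / s 2 := by
    rw [hx1]; simp [hs]
  rw [hx2, hx1, hx]
  exact solution_aux h0 h1 hsum hP hP' hQ

end SequenceA

end Recursions

/-! ### The sequence `C` and the kernel of `L`. -/

section SequenceC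

variable {F : Type*} [Field F] [CharP F 2] (σ : F →+* F) {s C : ℕ → F}
  (hs : ∀ i, σ (s i) = s (i + 1)) (hC0 : C 0 = 0) (hC1 : C 1 = 1)
  (hC : ∀ i, C (i + 2) = C (i + 1) + s i * C i)

include hs hC0 hC1 hC

/-- `C (i + 1)` and `σ (C i)` obey the same recursion, so each step multiplies their determinant by
`s (i + 1)`; signs vanish in characteristic 2. -/
theorem seqC_wronskian (i : ℕ) :
    C (i + 2) * σ (C i) + C (i + 1) * σ (C (i + 1)) = ∏ j ∈ Finset.range i, s (j + 1) := by
  induction i with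
  | zero => simp [hC0, hC1]
  | succ i ih =>
    have e : σ (C (i + 2)) = σ (C (i + 1)) + s (i + 1) * σ (C i) := by rw [hC i]; simp [hs]
    rw [Finset.prod_range_succ, ← ih, e, hC (i + 1)]
    linear_combination C (i + 2) * σ (C (i + 1)) * (CharTwo.two_eq_zero : (2 : F) = 0)

/-- If `Z_k` vanishes, then `C_k` is a zero of the linearized polynomial. -/
theorem seqC_mem_kernel {m : ℕ} (hper : s (m + 1) = s 0)
    (hN : ∏ j ∈ Finset.range (m + 1), s j = 1) (hZ : C (m + 2) + s 0 * σ (C m) = 0)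
    (hc : C (m + 1) ≠ 0) :
    s 1 * σ (σ (C (m + 1))) + σ (C (m + 1)) + s 0 * C (m + 1) = 0 := by
  have two : (2 : F) = 0 := CharTwo.two_eq_zero
  have hW := seqC_wronskian σ hs hC0 hC1 hC m
  rw [Finset.prod_range_succ'] at hN
  rw [← hW] at hN
  have he : σ (C (m + 2)) = σ (C (m + 1)) + s 0 * σ (C m) := by
    rw [hC m, map_add, map_mul, hs, hper]
  have h1 : C (m + 2) ^ 2 + s 0 * C (m + 1) * σ (C (m + 1)) = 1 := by
    linear_combination hN + C (m + 2) * hZ - C (m + 2) * s 0 * σ (C m) * two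
  -- Subtracting `h1` from its image under `σ` leaves `σ (C (m + 1))` times the desired expression.
  have h2 := congrArg σ h1
  simp only [map_add, map_mul, map_pow, hs, map_one, zero_add] at h2
  have he' : σ (C (m + 2)) = σ (C (m + 1)) + C (m + 2) := by
    linear_combination he + hZ - C (m + 2) * two
  rw [he'] at h2
  refine (mul_eq_zero.1 ?_).resolve_left ((map_ne_zero σ).2 hc)
  linear_combination h2 - h1 + (s 0 * C (m + 1) * σ (C (m + 1)) - σ (C (m + 1)) * C (m + 2)) * two

variable {W : ℕ → F} (hs0 : ∀ i, s i ≠ 0) (hWs : ∀ i, σ (W i) = W (i + 1)) (hW0 : ∀ i, W i ≠ 0)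
  (hL : ∀ i, s (i + 1) * W (i + 2) + W (i + 1) + s i * W i = 0)

omit hs in
include hs0 hW0 hL in
/-- A nonzero zero `W 0` of the linearized polynomial yields a closed form for `C_i ^ 2`. -/
theorem seqC_sq (i : ℕ) :
    C i ^ 2 = W i * W 0 * (∏ j ∈ Finset.range i, s j) *
      ∑ j ∈ Finset.range i, (s j * W j * W (j + 1))⁻¹ := by
  have two : (2 : F) = 0 := CharTwo.two_eq_zero
  -- Both `C i ^ 2` and `U i = W i * ∏ s j` satisfy `y (i + 2) = y (i + 1) + s i ^ 2 * y i`; the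
  -- formula is reduction of order from `U`.
  induction i using Nat.twoStepInduction with
  | zero => simp [hC0]
  | one =>
    have := hW0 0
    have := hW0 1
    have := hs0 0
    simp [hC1]
    field_simp
  | more i h1 h2 =>
    have := hW0 i
    have e1 : s i * W i * (s i * W i * W (i + 1))⁻¹ = (W (i + 1))⁻¹ := by
      have := hs0 i
      field_simp
    have e2 : s (i + 1) * W (i + 2) * (s (i + 1) * W (i + 1) * W (i + 2))⁻¹ = (W (i + 1))⁻¹ := by
      have := hs0 (i + 1)
      have := hW0 (i + 2)
      field_simp
    have e3 : C (i + 2) ^ 2 = C (i + 1) ^ 2 + s i ^ 2 * C i ^ 2 := by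
      rw [hC, CharTwo.add_sq, mul_pow]
    have e4 : s (i + 1) * W (i + 2) = W (i + 1) + s i * W i := by
      linear_combination hL i - (W (i + 1) + s i * W i) * two
    rw [e3, h1, h2]
    simp only [Finset.prod_range_succ, Finset.sum_range_succ, add_assoc, Nat.reduceAdd]
    generalize ∑ j ∈ Finset.range i, (s j * W j * W (j + 1))⁻¹ = S
    generalize ∏ j ∈ Finset.range i, s j = P
    rw [← sub_eq_zero]
    generalize (s i * W i * W (i + 1))⁻¹ = g, (s (i + 1) * W (i + 1) * W (i + 2))⁻¹ = g',
      (W (i + 1))⁻¹ = v at *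
    linear_combination -W 0 * s i * P * ((S + g) * e4 + e1 + e2 + v * two)

include hs0 hWs hW0 hL in
-- Both parts come from `seqC_sq`. For the second, square: in `C (m + 2) ^ 2` the summands `j = 0`
-- and `j = m + 1` agree by periodicity and cancel, and the rest matches `σ (C m) ^ 2`.
theorem seqC_of_kernel {m : ℕ} (hper : s (m + 1) = s 0) (hWper : W (m + 1) = W 0)
    (hN : ∏ j ∈ Finset.range (m + 1), s j = 1) :
    C (m + 1) ^ 2 = W 0 ^ 2 * ∑ j ∈ Finset.range (m + 1), (s j * W j * W (j + 1))⁻¹ ∧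
      C (m + 2) + s 0 * σ (C m) = 0 := by
  have two : (2 : F) = 0 := CharTwo.two_eq_zero
  have hW1 : W (m + 2) = W 1 := by rw [← hWs (m + 1), hWper, hWs]
  have key := seqC_sq hC0 hC1 hC hs0 hW0 hL
  have k1 := key (m + 1)
  rw [hN, hWper] at k1
  refine ⟨by rw [k1]; ring, ?_⟩
  have k2 := key (m + 2)
  rw [Finset.prod_range_succ, Finset.sum_range_succ, hN, hper, hWper, hW1] at k2
  have k0 := congrArg σ (key m)
  simp only [map_mul, map_pow, map_sum, map_prod, map_inv₀, hs, hWs, hWper, zero_add] at k0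
  rw [Finset.sum_range_succ'] at k2
  rw [Finset.prod_range_succ'] at hN
  generalize ∑ j ∈ Finset.range m, (s (j + 1) * W (j + 1) * W (j + 1 + 1))⁻¹ = S at *
  generalize ∏ j ∈ Finset.range m, s (j + 1) = P at *
  refine pow_eq_zero_iff (two_ne_zero) |>.1 ?_
  rw [CharTwo.add_sq, mul_pow, k2, k0, zero_add]
  linear_combination s 0 * W 0 * W 1 * S * hN +
    W 0 * W 1 * s 0 * (S + (s 0 * W 0 * W 1)⁻¹) * two

end SequenceC

/-! ### Powers of Frobenius, trace, norm and Hilbert 90. -/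

section Frobenius

variable {F : Type*} [Field F] [Finite F] [Algebra (ZMod 2) F]

/-- The `l`-th power of the Frobenius automorphism. -/
noncomputable def frob (F : Type*) [Field F] [Finite F] [Algebra (ZMod 2) F] (l : ℕ) :
    F ≃ₐ[ZMod 2] F :=
  FiniteField.frobeniusAlgEquivOfAlgebraic (ZMod 2) F ^ l

theorem frob_apply (l : ℕ) (x : F) : frob F l x = x ^ 2 ^ l := by
  rw [frob, AlgEquiv.coe_pow, FiniteField.coe_frobeniusAlgEquivOfAlgebraic_iterate, ZMod.card]

theorem frob_pow_apply (l i : ℕ) (x : F) : frob F l (x ^ 2 ^ (i * l)) = x ^ 2 ^ ((i + 1) * l) := by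
  rw [frob_apply, ← pow_mul, ← pow_add]
  ring_nf

theorem finrank_of_card {k : ℕ} (hF : Nat.card F = 2 ^ k) : Module.finrank (ZMod 2) F = k := by
  have := Module.natCard_eq_pow_finrank (K := ZMod 2) (V := F)
  rw [hF, Nat.card_zmod] at this
  exact (Nat.pow_right_injective le_rfl this).symm

omit [Algebra (ZMod 2) F] in
theorem pow_two_pow_of_modEq {k : ℕ} (hF : Nat.card F = 2 ^ k) {m n : ℕ} (h : m ≡ n [MOD k])
    (x : F) : x ^ 2 ^ m = x ^ 2 ^ n := by
  have hfix : ∀ (q : ℕ) (y : F), y ^ 2 ^ (k * q) = y := fun q y => by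
    induction q with
    | zero => simp
    | succ q ih =>
      rw [mul_add, mul_one, pow_add, pow_mul, ih, ← hF]
      have := Fintype.ofFinite F
      rw [Nat.card_eq_fintype_card, FiniteField.pow_card]
  have key : ∀ m, x ^ 2 ^ m = x ^ 2 ^ (m % k) := fun m => by
    conv_lhs => rw [← Nat.mod_add_div m k, pow_add, pow_mul, hfix]
  rw [key m, key n, h]

theorem trace_frob (l : ℕ) (x : F) :
    Algebra.trace (ZMod 2) F (frob F l x) = Algebra.trace (ZMod 2) F x :=
  Algebra.trace_eq_of_algEquiv (frob F l) x

theorem algebraMap_trace_eq_tr {k : ℕ} (hF : Nat.card F = 2 ^ k) (x : F) :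
    algebraMap (ZMod 2) F (Algebra.trace (ZMod 2) F x) = tr k x := by
  rw [FiniteField.algebraMap_trace_eq_sum_pow, finrank_of_card hF, Nat.card_zmod, tr]

variable {k l : ℕ} (hF : Nat.card F = 2 ^ k) (hcop : Nat.Coprime l k)

include hF hcop

/-- Periods `l` and `k` under squaring force the period `gcd(l, k) = 1`. -/
theorem eq_zero_or_one_of_frob_eq {x : F} (hx : frob F l x = x) : x = 0 ∨ x = 1 := by
  have h1 : Function.IsPeriodicPt (fun y : F => y ^ 2) l x := by
    rw [Function.IsPeriodicPt, Function.IsFixedPt, pow_iterate]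
    exact (frob_apply l x).symm.trans hx
  have h2 : Function.IsPeriodicPt (fun y : F => y ^ 2) k x := by
    rw [Function.IsPeriodicPt, Function.IsFixedPt, pow_iterate]
    simpa using pow_two_pow_of_modEq hF (m := k) (n := 0) (by simp [Nat.ModEq]) x
  have h3 := h1.gcd h2
  rw [hcop.gcd_eq_one] at h3
  have h4 : x ^ 2 = x := by simpa [Function.IsPeriodicPt, Function.IsFixedPt] using h3
  have : x * (x - 1) = 0 := by linear_combination h4
  rcases mul_eq_zero.1 this with h | h
  · exact Or.inl h
  · exact Or.inr (sub_eq_zero.1 h)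

theorem sum_frob_eq_trace (hk : 0 < k) (x : F) :
    ∑ j ∈ Finset.range k, x ^ 2 ^ (j * l) =
      algebraMap (ZMod 2) F (Algebra.trace (ZMod 2) F x) := by
  rw [algebraMap_trace_eq_tr hF, tr]
  have hmaps : Set.MapsTo (fun j => j * l % k) (Finset.range k : Set ℕ) (Finset.range k) :=
    fun j _ => by simpa using Nat.mod_lt _ hk
  have hinj : Set.InjOn (fun j => j * l % k) (Finset.range k : Set ℕ) := fun i hi j hj h => by
    have h' : i * l ≡ j * l [MOD k] := h
    have := Nat.ModEq.cancel_right_of_coprime (by rw [Nat.gcd_comm]; exact hcop) h'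
    exact Nat.ModEq.eq_of_lt_of_lt this (by simpa using hi) (by simpa using hj)
  refine Finset.sum_nbij (fun j => j * l % k) hmaps hinj
    (Finset.surjOn_of_injOn_of_card_le _ hmaps hinj le_rfl) fun j _ => ?_
  exact pow_two_pow_of_modEq hF (Nat.mod_modEq _ _).symm x

/-- The norm to `𝔽₂` of a nonzero element is `1`. -/
theorem prod_frob_eq_one {a : F} (ha : a ≠ 0) : ∏ j ∈ Finset.range k, a ^ 2 ^ (j * l) = 1 := by
  have h0 : ∏ j ∈ Finset.range k, a ^ 2 ^ (j * l) ≠ 0 :=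
    Finset.prod_ne_zero_iff.2 fun j _ => pow_ne_zero _ ha
  refine (eq_zero_or_one_of_frob_eq hF hcop ?_).resolve_left h0
  have e : frob F l (∏ j ∈ Finset.range k, a ^ 2 ^ (j * l)) =
      ∏ j ∈ Finset.range k, a ^ 2 ^ ((j + 1) * l) := by
    rw [map_prod]
    exact Finset.prod_congr rfl fun j _ => frob_pow_apply l j a
  have h1 := Finset.prod_range_succ (fun j => a ^ 2 ^ (j * l)) k
  rw [Finset.prod_range_succ', ← e, pow_two_pow_of_modEq hF (m := k * l) (n := 0 * l)
    (by simp [Nat.ModEq])] at h1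
  exact mul_right_cancel₀ (pow_ne_zero _ ha) h1

/-- The additive form of Hilbert 90. -/
theorem exists_add_frob_eq {u : F} (hu : Algebra.trace (ZMod 2) F u = 0) :
    ∃ x, x + frob F l x = u := by
  have : CharP F 2 := charP_of_injective_algebraMap (algebraMap (ZMod 2) F).injective 2
  let f : F →ₗ[ZMod 2] F := LinearMap.id + (frob F l).toLinearMap
  have hle : LinearMap.range f ≤ LinearMap.ker (Algebra.trace (ZMod 2) F) := by
    rintro _ ⟨x, rfl⟩
    simp [f, trace_frob, CharTwo.add_self_eq_zero]
  have hker : LinearMap.ker f = Submodule.span (ZMod 2) {1} := by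
    ext x
    rw [LinearMap.mem_ker, Submodule.mem_span_singleton]
    constructor
    · intro hx
      have : frob F l x = x := by
        have hx' : x + frob F l x = 0 := hx
        exact (CharTwo.add_eq_zero.1 hx').symm
      rcases eq_zero_or_one_of_frob_eq hF hcop this with rfl | rfl
      · exact ⟨0, by simp⟩
      · exact ⟨1, by simp⟩
    · rintro ⟨c, rfl⟩
      simp [f, CharTwo.add_self_eq_zero]
  have h1 := LinearMap.finrank_range_add_finrank_ker f
  rw [hker, finrank_span_singleton one_ne_zero] at h1
  have h2 := Module.Dual.finrank_ker_add_one_of_ne_zero (f := Algebra.trace (ZMod 2) F)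
    (Algebra.trace_ne_zero (ZMod 2) F)
  -- The image of `1 + σ` and the trace-zero hyperplane both have codimension one.
  have heq := Submodule.eq_of_le_of_finrank_eq hle (by omega)
  exact heq.ge hu

end Frobenius

/-! ### The linearized polynomial, its trace form and its kernel. -/

section Kernel

variable {F : Type*} [Field F] [Finite F] [Algebra (ZMod 2) F]

/-- The linearized polynomial `σ(a) σ²(x) + σ(x) + a x`, where `σ(x) = x^(2^l)`. -/
noncomputable def linPoly (l : ℕ) (a : F) : F →ₗ[ZMod 2] F where
  toFun x := frob F l a * frob F l (frob F l x) + frob F l x + a * x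
  map_add' x y := by simp only [map_add]; ring
  map_smul' c x := by simp only [map_smul, mul_smul_comm, smul_add, RingHom.id_apply]

theorem linPoly_apply (l : ℕ) (a x : F) :
    linPoly l a x = frob F l a * frob F l (frob F l x) + frob F l x + a * x := rfl

/-- The symmetric form `Tr(a σ(x) y + x y + a σ(y) x)`, whose radical is the kernel of
`linPoly l a`. -/
noncomputable def traceBilin (l : ℕ) (a : F) : F →ₗ[ZMod 2] F →ₗ[ZMod 2] ZMod 2 :=
  LinearMap.mk₂ (ZMod 2)
    (fun x y => Algebra.trace (ZMod 2) F (a * frob F l x * y + x * y + a * frob F l y * x))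
    (fun x x' y => by simp only [← map_add]; congr 1; simp only [map_add]; ring)
    (fun c x y => by
      rw [← map_smul]; congr 1
      simp only [map_smul, mul_smul_comm, smul_add, smul_mul_assoc])
    (fun x y y' => by simp only [← map_add]; congr 1; simp only [map_add]; ring)
    (fun c x y => by
      rw [← map_smul]; congr 1
      simp only [map_smul, mul_smul_comm, smul_add, smul_mul_assoc])

theorem traceBilin_apply (l : ℕ) (a x y : F) :
    traceBilin l a x y =
      Algebra.trace (ZMod 2) F (a * frob F l x * y + x * y + a * frob F l y * x) := rfl

theorem traceBilin_comm (l : ℕ) (a x y : F) : traceBilin l a x y = traceBilin l a y x := by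
  rw [traceBilin_apply, traceBilin_apply]
  congr 1
  ring

theorem traceBilin_eq_linPoly (l : ℕ) (a x y : F) :
    traceBilin l a x y = Algebra.trace (ZMod 2) F (linPoly l a x * frob F l y) := by
  rw [traceBilin_apply, add_assoc, map_add, map_add, ← trace_frob l (_ * y), ← trace_frob l (x * y),
    ← map_add, ← map_add, linPoly_apply]
  congr 1
  simp only [map_mul]
  ring

theorem traceBilin_self (l : ℕ) (a x : F) :
    traceBilin l a x x = Algebra.trace (ZMod 2) F x := by
  have : CharP F 2 := charP_of_injective_algebraMap (algebraMap (ZMod 2) F).injective 2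
  rw [traceBilin_apply, ← trace_frob 1 x, frob_apply 1]
  congr 1
  linear_combination a * frob F l x * x * (CharTwo.two_eq_zero : (2 : F) = 0)

/-- The trace of a solution of `linPoly l a x = 1` is the parity of the rank of `linPoly l a`. -/
theorem trace_of_linPoly_eq_one {l : ℕ} {a v : F} (hv : linPoly l a v = 1) :
    Algebra.trace (ZMod 2) F v =
      Module.finrank (ZMod 2) F + Module.finrank (ZMod 2) (LinearMap.ker (linPoly l a)) := by
  rw [← traceBilin_self l a v, ← finrank_top (ZMod 2) F]
  refine apply_self_eq_finrank_add_finrank_radical (traceBilin l a) (traceBilin_comm l a) ⊤ _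
    (fun x => ?_) v trivial fun x _ => ?_
  · rw [LinearMap.mem_ker]
    constructor
    · intro h
      refine ⟨trivial, fun y _ => ?_⟩
      rw [traceBilin_comm, traceBilin_eq_linPoly, h, zero_mul, map_zero]
    · rintro ⟨-, h⟩
      refine (traceForm_nondegenerate (ZMod 2) F).1 _ fun z => ?_
      obtain ⟨y, rfl⟩ := (frob F l).surjective z
      rw [Algebra.traceForm_apply, ← traceBilin_eq_linPoly, traceBilin_comm]
      exact h y trivial
  -- `v` is characteristic: `B(v,x) = Tr(1·σ(x)) = Tr(x) = B(x,x)`.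
  · rw [traceBilin_self, traceBilin_eq_linPoly, hv, one_mul, trace_frob]

variable {k l : ℕ} (hF : Nat.card F = 2 ^ k) (hcop : Nat.Coprime l k)

/-- The Wronskian of `w` and a second argument. -/
noncomputable def wronskian (l : ℕ) (a w : F) : F →ₗ[ZMod 2] F where
  toFun x := a * (frob F l w * x + w * frob F l x)
  map_add' x y := by simp only [map_add]; ring
  map_smul' c x := by simp only [map_smul, mul_smul_comm, ← smul_add, RingHom.id_apply]

theorem wronskian_apply (l : ℕ) (a w x : F) :
    wronskian l a w x = a * (frob F l w * x + w * frob F l x) := rfl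

theorem frob_wronskian {a w x : F} (hw : linPoly l a w = 0) (hx : linPoly l a x = 0) :
    frob F l (wronskian l a w x) = wronskian l a w x := by
  have : CharP F 2 := charP_of_injective_algebraMap (algebraMap (ZMod 2) F).injective 2
  rw [linPoly_apply] at hw hx
  simp only [wronskian_apply, map_mul, map_add]
  linear_combination frob F l x * hw + frob F l w * hx -
    (a * frob F l w * x + a * w * frob F l x + frob F l x * frob F l w) *
      (CharTwo.two_eq_zero : (2 : F) = 0)

include hF hcop

/-- Given a nonzero kernel element `w`, the kernel of `linPoly l a` has dimension `1` or `2`,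
according to the trace of `(a w σ(w))⁻¹`. -/
theorem finrank_ker_linPoly {a w : F} (ha : a ≠ 0) (hw0 : w ≠ 0)
    (hw : linPoly l a w = 0) :
    (Module.finrank (ZMod 2) (LinearMap.ker (linPoly l a)) : ZMod 2) = 1 ↔
      Algebra.trace (ZMod 2) F (a * w * frob F l w)⁻¹ ≠ 0 := by
  have : CharP F 2 := charP_of_injective_algebraMap (algebraMap (ZMod 2) F).injective 2
  have two : (2 : F) = 0 := CharTwo.two_eq_zero
  have hsw : frob F l w ≠ 0 := (_root_.map_ne_zero _).2 hw0
  set K := LinearMap.ker (linPoly l a) with hK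
  let δ : K →ₗ[ZMod 2] F := (wronskian l a w).domRestrict K
  have hδ : ∀ x : K, δ x = a * (frob F l w * x + w * frob F l x) := fun x => rfl
  have hδ01 : ∀ x : K, δ x = 0 ∨ δ x = 1 := fun x =>
    eq_zero_or_one_of_frob_eq hF hcop (frob_wronskian hw (LinearMap.mem_ker.1 x.2))
  -- Dividing by `w` turns `δ x = 1` into a Hilbert 90 equation for `x / w`, solvable exactly when
  -- the trace vanishes; `δ x = 0` means `x / w ∈ 𝔽₂`.
  have hquot : ∀ x : F, (x / w) + frob F l (x / w) =
      a * (frob F l w * x + w * frob F l x) * (a * w * frob F l w)⁻¹ := fun x => by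
    rw [map_div₀]; field_simp
  let w' : K := ⟨w, hw⟩
  have hw' : w' ≠ 0 := fun h => hw0 (congrArg Subtype.val h)
  have hker : LinearMap.ker δ = Submodule.span (ZMod 2) {w'} := by
    ext x
    rw [LinearMap.mem_ker, Submodule.mem_span_singleton]
    constructor
    · intro hx
      have h1 := hquot x
      rw [← hδ, hx, zero_mul] at h1
      rcases eq_zero_or_one_of_frob_eq hF hcop (CharTwo.add_eq_zero.1 h1).symm with h | h
      · refine ⟨0, Subtype.ext ?_⟩
        have : (x : F) = 0 := by simpa [hw0] using h
        simp [this]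
      · refine ⟨1, Subtype.ext ?_⟩
        have : (x : F) = w := by rwa [div_eq_one_iff_eq hw0] at h
        simp [this, w']
    · rintro ⟨c, rfl⟩
      rw [map_smul, hδ]
      simp only [w']
      rw [show a * (frob F l w * w + w * frob F l w) = 0 by
        linear_combination a * frob F l w * w * two, smul_zero]
  have hrank := LinearMap.finrank_range_add_finrank_ker δ
  rw [hker, finrank_span_singleton hw'] at hrank
  by_cases htr : Algebra.trace (ZMod 2) F (a * w * frob F l w)⁻¹ = 0
  · obtain ⟨x, hx⟩ := exists_add_frob_eq hF hcop htr
    have hx' : wronskian l a w (w * x) = 1 := by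
      have h2 : a * (w * frob F l w) * (x + frob F l x) = 1 := by
        rw [hx, ← mul_assoc]
        exact mul_inv_cancel₀ (by simp [ha, hw0])
      rw [wronskian_apply, map_mul]
      linear_combination h2
    have hmem : linPoly l a (w * x) = 0 := by
      have h3 := congrArg (frob F l) hx'
      rw [linPoly_apply] at hw ⊢
      rw [wronskian_apply] at hx' h3
      simp only [map_mul, map_add, map_one] at hx' h3 ⊢
      refine (mul_eq_zero.1 ?_).resolve_left hsw
      linear_combination frob F l w * frob F l x * hw + h3 - hx' + (frob F l w * a * w * x -
        frob F l w * frob F l a * frob F l (frob F l w) * frob F l x) * two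
    have hrange : LinearMap.range δ = Submodule.span (ZMod 2) {1} := by
      apply le_antisymm
      · rintro _ ⟨y, rfl⟩
        rcases hδ01 y with h | h
        · rw [h]; exact zero_mem _
        · rw [h]; exact Submodule.mem_span_singleton_self 1
      · rw [Submodule.span_singleton_le_iff_mem]
        exact ⟨⟨w * x, hmem⟩, hx'⟩
    rw [hrange, finrank_span_singleton one_ne_zero] at hrank
    rw [← hrank, htr]
    simp only [ne_eq, not_true_eq_false, iff_false]
    decide
  · have hrange : LinearMap.range δ = ⊥ := by
      rw [LinearMap.range_eq_bot]
      ext x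
      refine (hδ01 x).resolve_right fun h => htr ?_
      have h1 := hquot x
      rw [← hδ, h, one_mul] at h1
      rw [← h1, map_add, trace_frob, CharTwo.add_self_eq_zero]
    rw [hrange, finrank_bot] at hrank
    rw [← hrank]
    simpa using htr

end Kernel

/-! ### Evaluating the polynomials at field elements. -/

section Evaluation

variable {F : Type*} [Field F]

/-- The default `polyA F l 0 = 0` extends the recursion to `i = 0`. -/
theorem eval_polyA_rec (l : ℕ) {d : F} (hd : d ≠ 0) (i : ℕ) :
    (polyA F l (i + 2)).eval d = d ^ 2 ^ ((i + 1) * l) * (polyA F l (i + 1)).eval d +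
      d ^ 2 ^ ((i + 1) * l) / d ^ 2 ^ (i * l) * (polyA F l i).eval d := by
  cases i with
  | zero => simp [polyA, pow_succ]
  | succ i =>
    have h : 2 ^ ((i + 1) * l) ≤ 2 ^ ((i + 2) * l) :=
      Nat.pow_le_pow_right two_pos (Nat.mul_le_mul_right l (by omega))
    simp [polyA, pow_sub₀ d hd h, div_eq_mul_inv]

theorem eval_polyB_rec (l : ℕ) {d : F} (hd : d ≠ 0) (i : ℕ) :
    (polyB F l (i + 3)).eval d = d ^ 2 ^ ((i + 2) * l) * (polyB F l (i + 2)).eval d +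
      d ^ 2 ^ ((i + 2) * l) / d ^ 2 ^ ((i + 1) * l) * (polyB F l (i + 1)).eval d := by
  have h : 2 ^ ((i + 1) * l) ≤ 2 ^ ((i + 2) * l) :=
    Nat.pow_le_pow_right two_pos (Nat.mul_le_mul_right l (by omega))
  simp [polyB, pow_sub₀ d hd h, div_eq_mul_inv]

theorem eval_polyC_rec (l : ℕ) (a : F) (i : ℕ) :
    (polyC F l (i + 2)).eval a =
      (polyC F l (i + 1)).eval a + a ^ 2 ^ (i * l) * (polyC F l i).eval a := by
  cases i <;> simp [polyC]

theorem eval_polyR_succ (k l : ℕ) {m : ℕ} (hm : invMod l k = m + 1) (d : F) :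
    (polyR F k l).eval d =
      ∑ i ∈ Finset.range (m + 1), (polyA F l (i + 1)).eval d + (polyB F l (m + 1)).eval d := by
  rw [polyR, hm, eval_add, eval_finsetSum]
  congr 1
  rw [Finset.range_eq_Ico, Finset.sum_Ico_add' (fun i => (polyA F l i).eval d)]
  rfl

variable [Finite F] [Algebra (ZMod 2) F]

/-- `σ` shifts the coefficients of the `A` recursion to those of the `B` recursion; the initial
values agree. -/
theorem eval_polyB_eq (l : ℕ) {d : F} (hd : d ≠ 0) (i : ℕ) :
    (polyB F l (i + 1)).eval d = frob F l ((polyA F l i).eval d) / d := by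
  induction i using Nat.twoStepInduction with
  | zero => simp [polyA, polyB]
  | one => simp [polyA, polyB, frob_apply, pow_sub₀ d hd Nat.one_le_two_pow, div_eq_mul_inv]
  | more i h1 h2 =>
    rw [eval_polyB_rec l hd, h1, h2, eval_polyA_rec l hd, map_add, map_mul, map_mul, map_div₀,
      frob_pow_apply, frob_pow_apply]
    ring

/-- The value of the Dobbertin polynomial at `a⁻¹` solves `linPoly l a x = 1`. -/
theorem linPoly_eval_polyR {k l : ℕ} (hF : Nat.card F = 2 ^ k) (hk : 1 < k)
    (hcop : Nat.Coprime l k) {a : F} (ha : a ≠ 0) :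
    linPoly l a ((polyR F k l).eval a⁻¹) = 1 := by
  have : CharP F 2 := charP_of_injective_algebraMap (algebraMap (ZMod 2) F).injective 2
  have hd : a⁻¹ ≠ 0 := inv_ne_zero ha
  obtain ⟨hpos, -, hmod⟩ := invMod_spec hk hcop
  obtain ⟨m, hm⟩ := Nat.exists_eq_succ_of_ne_zero hpos.ne'
  rw [hm, mul_comm] at hmod
  -- Since `l'l ≡ 1` modulo `k` and `l' = m + 1`, the map `σ^(m+1)` is squaring, as `seqA_solution`
  -- requires.
  have hsol := seqA_solution (frob F l : F →+* F) (s := fun i => a⁻¹ ^ 2 ^ (i * l))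
    (A := fun i => (polyA F l i).eval a⁻¹) (fun i => frob_pow_apply l i _)
    (fun i => pow_ne_zero _ hd) (by simp [polyA]) (by simp [polyA]) (eval_polyA_rec l hd) m
    (by simpa using pow_two_pow_of_modEq hF hmod a⁻¹) ((polyR F k l).eval a⁻¹)
    (by
      rw [eval_polyR_succ k l hm, eval_polyB_eq l hd]
      simp)
  have hfa : frob F l a ≠ 0 := (_root_.map_ne_zero _).2 ha
  have h1 : a⁻¹ ^ 2 ^ (1 * l) = (frob F l a)⁻¹ := by rw [one_mul, inv_pow, frob_apply]
  simp only [RingHom.coe_coe, h1] at hsol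
  rw [linPoly_apply, hsol, ← mul_assoc, mul_inv_cancel₀ hfa]
  simp only [zero_mul, pow_zero, pow_one, div_inv_eq_mul]
  linear_combination (frob F l ((polyR F k l).eval a⁻¹) + a * (polyR F k l).eval a⁻¹) *
    (CharTwo.two_eq_zero : (2 : F) = 0)

variable {k l : ℕ} (hF : Nat.card F = 2 ^ k) (hk : 1 < k) (hcop : Nat.Coprime l k)

include hF hk hcop

theorem odd_finrank_ker_iff {a : F} (ha : a ≠ 0) :
    (Module.finrank (ZMod 2) (LinearMap.ker (linPoly l a)) : ZMod 2) = 1 ↔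
      (polyZ F l k).eval a = 0 ∧ (polyC F l k).eval a ≠ 0 := by
  have : CharP F 2 := charP_of_injective_algebraMap (algebraMap (ZMod 2) F).injective 2
  obtain ⟨n, rfl⟩ : ∃ n, k = n + 2 := ⟨k - 2, by omega⟩
  have hper : ∀ x : F, x ^ 2 ^ ((n + 1 + 1) * l) = x ^ 2 ^ (0 * l) := fun x =>
    pow_two_pow_of_modEq hF (by simp [Nat.ModEq]) x
  have hN := prod_frob_eq_one hF hcop ha
  have hs := fun i => frob_pow_apply (F := F) l i a
  have hZe : (polyZ F l (n + 2)).eval a = (polyC F l (n + 1 + 2)).eval a +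
      a ^ 2 ^ (0 * l) * frob F l ((polyC F l (n + 1)).eval a) := by
    simp [polyZ, frob_apply]
  have hC0 : (polyC F l 0).eval a = 0 := by simp [polyC]
  have hC1 : (polyC F l 1).eval a = 1 := by simp [polyC]
  have main : ∀ w : F, w ≠ 0 → linPoly l a w = 0 →
      (polyC F l (n + 2)).eval a ^ 2 = w ^ 2 *
        algebraMap (ZMod 2) F (Algebra.trace (ZMod 2) F (a * w * frob F l w)⁻¹) ∧
      (polyZ F l (n + 2)).eval a = 0 := fun w hw0 hw => by
    have hL : ∀ i, a ^ 2 ^ ((i + 1) * l) * w ^ 2 ^ ((i + 2) * l) + w ^ 2 ^ ((i + 1) * l)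
        + a ^ 2 ^ (i * l) * w ^ 2 ^ (i * l) = 0 := fun i => by
      induction i with
      | zero =>
        rw [linPoly_apply] at hw
        rw [← hs 0, ← frob_pow_apply l 1 w, ← frob_pow_apply l 0 w]
        simpa using hw
      | succ i ih =>
        have := congrArg (frob F l) ih
        simpa only [map_add, map_mul, map_zero, frob_pow_apply] using this
    have key := seqC_of_kernel (frob F l : F →+* F) (s := fun i => a ^ 2 ^ (i * l))
      (C := fun i => (polyC F l i).eval a) (W := fun i => w ^ 2 ^ (i * l)) hs hC0 hC1
      (eval_polyC_rec l a) (fun i => pow_ne_zero _ ha) (fun i => frob_pow_apply l i w)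
      (fun i => pow_ne_zero _ hw0) hL (m := n + 1) (hper a) (hper w) hN
    refine ⟨?_, hZe.trans key.2⟩
    rw [← sum_frob_eq_trace hF hcop (by omega)]
    simp only [mul_inv, mul_pow, inv_pow, frob_apply] at key ⊢
    refine (key.1).trans ?_
    simp only [zero_mul, pow_zero, pow_one]
    congr 1
    refine Finset.sum_congr rfl fun j _ => ?_
    rw [← pow_mul w, ← pow_add, show l + j * l = (j + 1) * l by ring]
  constructor
  · intro hodd
    obtain ⟨w, hw, hw0⟩ := Submodule.exists_mem_ne_zero_of_ne_bot
      (p := LinearMap.ker (linPoly l a)) (fun h => by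
        rw [h, finrank_bot, Nat.cast_zero] at hodd
        exact zero_ne_one hodd)
    have htr := (finrank_ker_linPoly hF hcop ha hw0 hw).1 hodd
    obtain ⟨h1, h2⟩ := main w hw0 hw
    refine ⟨h2, fun hC => htr ?_⟩
    rw [hC] at h1
    simpa [hw0] using h1
  · rintro ⟨hZ, hC⟩
    have hw : linPoly l a ((polyC F l (n + 2)).eval a) = 0 := by
      have := seqC_mem_kernel (frob F l : F →+* F) (s := fun i => a ^ 2 ^ (i * l))
        (C := fun i => (polyC F l i).eval a) hs hC0 hC1 (eval_polyC_rec l a) (m := n + 1)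
        (hper a) hN (hZe.symm.trans hZ) hC
      rw [linPoly_apply]
      simpa [frob_apply] using this
    rw [finrank_ker_linPoly hF hcop ha hC hw]
    intro htr
    have h1 := (main _ hC hw).1
    rw [htr, map_zero, mul_zero] at h1
    exact hC (pow_eq_zero_iff two_ne_zero |>.1 h1)

end Evaluation

end DobbertinTrace

theorem mainTheorem8 {F : Type*} [Field F] {k l : ℕ} (hF : Nat.card F = 2 ^ k)
    (hl : 0 < l) (hlk : l < k) (hcop : Nat.gcd l k = 1) (a : F) (ha : a ≠ 0) :
    DobbertinTrace.tr k ((DobbertinTrace.polyR F k l).eval a⁻¹ + 1) = 1 ↔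
      (DobbertinTrace.polyZ F l k).eval a = 0 ∧ (DobbertinTrace.polyC F l k).eval a ≠ 0 := by
  have : Finite F := Nat.finite_of_card_ne_zero (by rw [hF]; positivity)
  have : Fintype F := Fintype.ofFinite F
  have : CharP F 2 := charP_of_card_eq_prime_pow (by rw [← Nat.card_eq_fintype_card, hF])
  let _ : Algebra (ZMod 2) F := ZMod.algebra F 2
  have hk : 1 < k := by omega
  rw [← DobbertinTrace.odd_finrank_ker_iff hF hk hcop ha,
    ← DobbertinTrace.algebraMap_trace_eq_tr hF, map_add,
    DobbertinTrace.trace_of_linPoly_eq_one (DobbertinTrace.linPoly_eval_polyR hF hk hcop ha)]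
  -- `Tr(1) = k` cancels the `k` in the rank parity, leaving `dim ker L`.
  have h1 : Algebra.trace (ZMod 2) F 1 = Module.finrank (ZMod 2) F := by
    simpa using Algebra.trace_algebraMap (S := F) (1 : ZMod 2)
  rw [h1, add_right_comm, CharTwo.add_self_eq_zero, zero_add,
    map_eq_one_iff _ (algebraMap (ZMod 2) F).injective]
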